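/- Let $n\ge 0$ be an integer and let $D=(\mathcal W_0,\ldots,\mathcal W_n)\in\mathbb C^{n+1}$ be a non-zero vector. Put $\|D\|^2=|\mathcal W_0|^2+\cdots+|\mathcal W_n|^2$ and, for every integer $k\ge 0$, $$a(n,k,D)=\sum_{\substack{\ell_0+\cdots+\ell_n=k\\ \ell_0,\ldots,\ell_n\ge 0}}\left(\frac{k!}{\ell_0!\,\ell_1!\cdots\ell_n!}\right)^{2}|\mathcal W_0|^{2\ell_0}\cdots|\mathcal W_n|^{2\ell_n},$$ where the sum is over integers $\ell_0,\ldots,\ell_n$ and $0^0=1$. Then the series over $j$ below converges, and $$\sum_{j=1}^{\infty}\frac1j\sum_{k=0}^{j}\binom jk\frac{(-1)^k\,a(n,k,D)}{\|D\|^{2k}}\left(\frac{1}{(n+1)^k}-\frac1{k!}\right)=\log(n+1)+\gamma,$$ where $\gamma$ denotes Euler's constant. -/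

import Mathlib

/-- The coefficient `a(n, k, D)`: the sum, over all tuples `(ℓ₀, …, ℓₙ)` of natural numbers with
`ℓ₀ + ⋯ + ℓₙ = k`, of the squared multinomial coefficient `(k! / (ℓ₀! ⋯ ℓₙ!))²` times
`|W₀|^(2ℓ₀) ⋯ |Wₙ|^(2ℓₙ)`, where `D = (W₀, …, Wₙ)`. -/
noncomputable def mahlerCoeff (n k : ℕ) (D : EuclideanSpace ℂ (Fin (n + 1))) : ℝ :=
  ∑ l ∈ Finset.piAntidiag (Finset.univ : Finset (Fin (n + 1))) k,
    (Nat.multinomial Finset.univ l : ℝ) ^ 2 * ∏ m, ‖D m‖ ^ (2 * l m)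

open MeasureTheory Filter Topology Polynomial

-- On the torus with its Haar probability measure, put `X = |∑ W_i z_i|² / ‖D‖²`. By orthogonality
-- of characters, `a(n,k,D) / ‖D‖^(2k)` is the `k`-th moment of `X`, and Cauchy–Schwarz gives `X ≤ c
-- := n + 1`. The inner sum over `k` is therefore `E[(1 - X/c)^j - L_j(X)]`, with `L_j` the Laguerre
-- polynomial.
--
-- Divide by `j` and sum: pointwise, for `0 < x ≤ c`, `∑ (1 - x/c)^j / j = -log (x/c)` and `∑ L_j(x)
-- / j = -log x - γ`. The logarithms of `x` cancel and leave `log c + γ`. Dominated convergence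
-- passes to the expectation (`tendsto_sum_moments`); it needs partial sums bounded by a multiple of
-- `1 + |log X|`, and `log X` integrable, which comes from Jensen's formula
-- (`integrable_log_norm_torusForm`).
--
-- For the Laguerre series, the partial sums `S_N` satisfy `(S_N + log)' = L_N / x`, and the
-- differential equation of `L_N` shows that `S_N(x) + log x - S_N(1)` tends to `0`. The limit of
-- `S_N(1)` is found by integrating against an exponential.

local instance fact_two_pi_pos : Fact (0 < 2 * Real.pi) := ⟨Real.two_pi_pos⟩

/-! ### Laguerre polynomials: differential equation and bounds -/

/-- The Laguerre polynomial `L_N`. -/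
noncomputable def laguerre (N : ℕ) : ℝ[X] :=
  ∑ k ∈ Finset.range (N + 1), C ((N.choose k : ℝ) * ((-1) ^ k / (k.factorial : ℝ))) * X ^ k

lemma laguerre_coeff (N k : ℕ) :
    (laguerre N).coeff k = (N.choose k : ℝ) * ((-1) ^ k / (k.factorial : ℝ)) := by
  simp only [laguerre, finsetSum_coeff, coeff_C_mul_X_pow]
  rw [Finset.sum_ite_eq]
  split_ifs with h
  · rfl
  · rw [Nat.choose_eq_zero_of_lt (by simpa using h)]
    simp

lemma laguerre_zero : laguerre 0 = 1 := by
  simp [laguerre]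

lemma laguerre_eval_zero (N : ℕ) : (laguerre N).eval 0 = 1 := by
  rw [← coeff_zero_eq_eval_zero, laguerre_coeff]
  simp

lemma laguerre_eval (N : ℕ) (x : ℝ) :
    (laguerre N).eval x =
      ∑ k ∈ Finset.range (N + 1), (N.choose k : ℝ) * ((-1) ^ k / (k.factorial : ℝ)) * x ^ k := by
  simp [laguerre, eval_finsetSum]

lemma X_mul_derivative_laguerre_succ (N : ℕ) :
    X * derivative (laguerre (N + 1)) = C ((N : ℝ) + 1) * (laguerre (N + 1) - laguerre N) := by
  ext k
  rcases k with _ | k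
  · rw [coeff_X_mul_zero]
    simp [laguerre_coeff]
  · rw [coeff_X_mul, coeff_derivative, coeff_C_mul, coeff_sub, laguerre_coeff, laguerre_coeff]
    have h1 : ((N + 1 : ℕ) : ℝ) * N.choose k = (N + 1).choose (k + 1) * ((k + 1 : ℕ) : ℝ) := by
      exact_mod_cast Nat.add_one_mul_choose_eq N k
    have h2 : ((N + 1).choose (k + 1) : ℝ) = N.choose k + N.choose (k + 1) := by
      exact_mod_cast Nat.choose_succ_succ N k
    push_cast at h1
    linear_combination (-((-1) ^ (k + 1) / ((k + 1).factorial : ℝ))) * h1 -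
      ((-1) ^ (k + 1) / ((k + 1).factorial : ℝ)) * ((N : ℝ) + 1) * h2

lemma laguerre_ode (N : ℕ) :
    X * derivative (derivative (laguerre N)) + (1 - X) * derivative (laguerre N) +
      C (N : ℝ) * laguerre N = 0 := by
  have key : ∀ k, (laguerre N).coeff (k + 1) * ((k : ℝ) + 1) ^ 2 +
      ((N : ℝ) - k) * (laguerre N).coeff k = 0 := by
    intro k
    rw [laguerre_coeff, laguerre_coeff, Nat.factorial_succ, pow_succ]
    have h : (N.choose (k + 1) : ℝ) * (k + 1) = N.choose k * ((N : ℝ) - k) := by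
      rcases le_or_gt k N with h | h
      · rw [← Nat.cast_sub h]
        exact_mod_cast Nat.choose_succ_right_eq N k
      · rw [Nat.choose_eq_zero_of_lt h, Nat.choose_eq_zero_of_lt (by omega)]
        simp
    have hk : (k.factorial : ℝ) ≠ 0 := by exact_mod_cast k.factorial_ne_zero
    push_cast
    field_simp
    linear_combination (-(-1) ^ k) * h
  ext k
  rw [sub_mul, one_mul]
  rcases k with _ | k
  · have := key 0
    simp only [coeff_add, coeff_sub, coeff_X_mul_zero, coeff_derivative, coeff_C_mul, coeff_zero]
    push_cast at this ⊢
    linear_combination this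
  · have := key (k + 1)
    simp only [coeff_add, coeff_sub, coeff_X_mul, coeff_derivative, coeff_C_mul, coeff_zero]
    push_cast at this ⊢
    linear_combination this

lemma laguerre_ode_eval (N : ℕ) (x : ℝ) :
    x * (derivative (derivative (laguerre N))).eval x + (1 - x) * (derivative (laguerre N)).eval x +
      N * (laguerre N).eval x = 0 := by
  have := congrArg (eval x) (laguerre_ode N)
  simpa using this

lemma mul_derivative_laguerre_succ_eval (N : ℕ) (x : ℝ) :
    x * (derivative (laguerre (N + 1))).eval x =
      ((N : ℝ) + 1) * ((laguerre (N + 1)).eval x - (laguerre N).eval x) := by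
  have := congrArg (eval x) (X_mul_derivative_laguerre_succ N)
  simpa using this

/-- The energy estimate from the Laguerre differential equation. -/
lemma laguerre_energy_le {N : ℕ} (hN : 1 ≤ N) {x : ℝ} (hx : 0 ≤ x) :
    (laguerre N).eval x ^ 2 + x * (derivative (laguerre N)).eval x ^ 2 / N ≤
      Real.exp (2 * x) := by
  have hN' : (0 : ℝ) < N := by exact_mod_cast hN
  let L := laguerre N
  -- By the differential equation the bracket has derivative `(2y - 1) L'² / N`; the factor `exp
  -- (-2y)` cancels the growing part `2y L'² / N`, so `F` decreases from `F 0 = 1`.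
  let F : ℝ → ℝ := fun y => Real.exp (-2 * y) *
    (L.eval y ^ 2 + y * (derivative L).eval y ^ 2 / N)
  have hF : ∀ y, HasDerivAt F (Real.exp (-2 * y) *
      (-2 * L.eval y ^ 2 - (derivative L).eval y ^ 2 / N)) y := by
    intro y
    have h1 := L.hasDerivAt y
    have h2 := (derivative L).hasDerivAt y
    have h3 : HasDerivAt (fun y : ℝ => Real.exp (-2 * y)) (Real.exp (-2 * y) * (-2 * 1)) y :=
      ((hasDerivAt_id y).const_mul (-2)).exp
    have h := h3.mul ((h1.pow 2).add (((hasDerivAt_id y).mul (h2.pow 2)).div_const (N : ℝ)))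
    refine h.congr_deriv ?_
    have ode := laguerre_ode_eval N y
    change y * (derivative (derivative L)).eval y + (1 - y) * (derivative L).eval y +
      N * L.eval y = 0 at ode
    simp only [id, Pi.add_apply, Pi.mul_apply, Pi.pow_apply]
    field_simp
    push_cast
    linear_combination 2 * (derivative L).eval y * ode
  have hanti : AntitoneOn F (Set.Ici 0) := by
    refine antitoneOn_of_deriv_nonpos (convex_Ici 0)
      (fun y _ => (hF y).continuousAt.continuousWithinAt)
      (fun y _ => (hF y).differentiableAt.differentiableWithinAt) fun y _ => ?_
    rw [(hF y).deriv]
    refine mul_nonpos_of_nonneg_of_nonpos (Real.exp_pos _).le ?_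
    have : 0 ≤ (derivative L).eval y ^ 2 / N := by positivity
    nlinarith [sq_nonneg (L.eval y)]
  have h := hanti (Set.mem_Ici.2 le_rfl) (Set.mem_Ici.2 hx) hx
  have h0 : F 0 = 1 := by
    simp [F, L, laguerre_eval_zero]
  rw [h0] at h
  have he : Real.exp (2 * x) * Real.exp (-2 * x) = 1 := by
    rw [← Real.exp_add]; simp
  calc _ = Real.exp (2 * x) * F x := by
        simp only [F]; rw [← mul_assoc, he, one_mul]
    _ ≤ Real.exp (2 * x) * 1 := by gcongr
    _ = _ := mul_one _

lemma abs_laguerre_eval_le (N : ℕ) {x : ℝ} (hx : 0 ≤ x) :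
    |(laguerre N).eval x| ≤ Real.exp x := by
  rcases Nat.eq_zero_or_pos N with rfl | hN
  · simp [laguerre_zero, hx]
  · refine abs_le_of_sq_le_sq ?_ (Real.exp_pos _).le
    have h := laguerre_energy_le hN hx
    have : 0 ≤ x * (derivative (laguerre N)).eval x ^ 2 / N := by positivity
    rw [← Real.exp_nat_mul]
    push_cast
    linarith

lemma abs_derivative_laguerre_eval_div_le {N : ℕ} (hN : 1 ≤ N) {x : ℝ} (hx : 0 < x) :
    |(derivative (laguerre N)).eval x / N| ≤ Real.exp x / √x / √N := by
  have hN' : (0 : ℝ) < N := by exact_mod_cast hN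
  have h := laguerre_energy_le hN hx.le
  refine abs_le_of_sq_le_sq ?_ (by positivity)
  rw [div_pow, div_pow, div_pow, Real.sq_sqrt hx.le, Real.sq_sqrt hN'.le, ← Real.exp_nat_mul]
  push_cast
  have h2 : x * (derivative (laguerre N)).eval x ^ 2 / N ≤ Real.exp (2 * x) := by
    nlinarith [sq_nonneg ((laguerre N).eval x)]
  rw [div_div, div_le_div_iff₀ (by positivity) (by positivity)]
  rw [div_le_iff₀ hN'] at h2
  nlinarith

/-! ### Pointwise behaviour of the partial sums, up to a constant -/

/-- Partial sums of `∑ L_j / j`. -/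
noncomputable def laguerreSum (N : ℕ) : ℝ[X] :=
  ∑ j ∈ Finset.Icc 1 N, C (1 / (j : ℝ)) * laguerre j

lemma laguerreSum_succ (N : ℕ) :
    laguerreSum (N + 1) = laguerreSum N + C (1 / ((N : ℝ) + 1)) * laguerre (N + 1) := by
  rw [laguerreSum, Finset.sum_Icc_succ_top (by omega), laguerreSum]
  push_cast
  rfl

/-- The sum telescopes, since `x L_{j+1}' / (j + 1) = L_{j+1} - L_j`. -/
lemma mul_derivative_laguerreSum_eval (N : ℕ) (x : ℝ) :
    x * (derivative (laguerreSum N)).eval x = (laguerre N).eval x - 1 := by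
  induction N with
  | zero => simp [laguerreSum, laguerre_zero]
  | succ N ih =>
    rw [laguerreSum_succ]
    have h := mul_derivative_laguerre_succ_eval N x
    have hN : (N : ℝ) + 1 ≠ 0 := by positivity
    simp only [derivative_add, derivative_C_mul, eval_add, eval_mul, eval_C, mul_add, ih]
    rw [mul_left_comm, h]
    field_simp
    ring

lemma hasDerivAt_laguerreSum_add_log (N : ℕ) {x : ℝ} (hx : 0 < x) :
    HasDerivAt (fun y => (laguerreSum N).eval y + Real.log y) ((laguerre N).eval x / x) x := by
  refine (((laguerreSum N).hasDerivAt x).add (Real.hasDerivAt_log hx.ne')).congr_deriv ?_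
  have := mul_derivative_laguerreSum_eval N x
  field_simp
  linear_combination this

lemma abs_laguerreSum_add_log_sub_le (N : ℕ) {x : ℝ} (hx : 0 < x) :
    |(laguerreSum N).eval x + Real.log x - (laguerreSum N).eval 1| ≤
      Real.exp (x + 1) * |Real.log x| := by
  -- In the variable `u = log y` the derivative `L_N(y) / y` becomes `L_N(exp u)`, which is not
  -- singular at `y = 0`; the mean value inequality then costs only `|log x|`.
  let G : ℝ → ℝ := fun u => (laguerreSum N).eval (Real.exp u) + Real.log (Real.exp u)
  have hG : ∀ u, HasDerivAt G ((laguerre N).eval (Real.exp u)) u := by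
    intro u
    have h := (hasDerivAt_laguerreSum_add_log N (Real.exp_pos u)).comp u (Real.hasDerivAt_exp u)
    refine h.congr_deriv ?_
    field_simp
  have h := Convex.norm_image_sub_le_of_norm_hasDerivWithin_le (f := G)
    (f' := fun u => (laguerre N).eval (Real.exp u)) (C := Real.exp (x + 1))
    (s := Set.uIcc 0 (Real.log x)) (x := 0) (y := Real.log x)
    (fun u _ => (hG u).hasDerivWithinAt) (fun u hu => ?_) (convex_uIcc _ _)
    Set.left_mem_uIcc Set.right_mem_uIcc
  · simpa [G, Real.exp_log hx] using h
  · rw [Real.norm_eq_abs]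
    refine (abs_laguerre_eval_le N (Real.exp_pos u).le).trans (Real.exp_le_exp.2 ?_)
    rcases Set.mem_uIcc.1 hu with h | h
    · have := Real.exp_le_exp.2 h.2
      rw [Real.exp_log hx] at this
      linarith
    · have := Real.exp_le_exp.2 h.2
      rw [Real.exp_zero] at this
      linarith

lemma tendsto_laguerreSum_add_log_sub {x : ℝ} (hx : 0 < x) :
    Tendsto (fun N => (laguerreSum N).eval x + Real.log x - (laguerreSum N).eval 1) atTop
      (𝓝 0) := by
  -- The derivative `L_N / y` is not visibly small. The differential equation gives `(L_N'' - L_N')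
  -- / N = -L_N / y - L_N' / (N y)`, so the added term cancels it and leaves `-L_N' / (N y)`, of
  -- order `N^(-1/2)` by the energy estimate. The added term itself tends to `0`.
  let h : ℕ → ℝ → ℝ := fun N y => (laguerreSum N).eval y + Real.log y +
    ((derivative (laguerre N)).eval y - (laguerre N).eval y) / N
  have hd : ∀ N, 1 ≤ N → ∀ y, 0 < y →
      HasDerivAt (h N) (-((derivative (laguerre N)).eval y / N) / y) y := by
    intro N hN y hy
    have hN' : (0 : ℝ) < N := by exact_mod_cast hN
    refine ((hasDerivAt_laguerreSum_add_log N hy).add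
      ((((derivative (laguerre N)).hasDerivAt y).sub ((laguerre N).hasDerivAt y)).div_const
        (N : ℝ))).congr_deriv ?_
    have := laguerre_ode_eval N y
    field_simp
    linear_combination this
  have hm : 0 < min 1 x := lt_min one_pos hx
  let K := Real.exp (x + 1) / √(min 1 x)
  have hK : ∀ N, 1 ≤ N → ∀ y ∈ Set.uIcc 1 x,
      |(derivative (laguerre N)).eval y / N| ≤ K / √N := by
    intro N hN y hy
    have hy1 : min 1 x ≤ y := hy.1
    have hy2 : y ≤ x + 1 := hy.2.trans (max_le (by linarith) (by linarith))
    refine (abs_derivative_laguerre_eval_div_le hN (hm.trans_le hy1)).trans ?_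
    simp only [K]
    gcongr
  have hK' : ∀ N, 1 ≤ N → ∀ y ∈ Set.uIcc 1 x,
      |((derivative (laguerre N)).eval y - (laguerre N).eval y) / N| ≤
        K / √N + Real.exp (x + 1) / N := by
    intro N hN y hy
    have hy1 : min 1 x ≤ y := hy.1
    have hy2 : y ≤ x + 1 := hy.2.trans (max_le (by linarith) (by linarith))
    rw [sub_div]
    refine (abs_sub _ _).trans (add_le_add (hK N hN y hy) ?_)
    rw [abs_div, Nat.abs_cast]
    gcongr
    exact (abs_laguerre_eval_le N (hm.le.trans hy1)).trans (Real.exp_le_exp.2 hy2)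
  have hdiff : ∀ N, 1 ≤ N → |h N x - h N 1| ≤ K / √N / min 1 x * |x - 1| := by
    intro N hN
    have := Convex.norm_image_sub_le_of_norm_hasDerivWithin_le (f := h N)
      (f' := fun y => -((derivative (laguerre N)).eval y / N) / y) (C := K / √N / min 1 x)
      (s := Set.uIcc 1 x) (x := 1) (y := x)
      (fun y hy => (hd N hN y (hm.trans_le hy.1)).hasDerivWithinAt) (fun y hy => ?_)
      (convex_uIcc _ _) Set.left_mem_uIcc Set.right_mem_uIcc
    · simpa using this
    · have hy1 : min 1 x ≤ y := hy.1
      rw [Real.norm_eq_abs, abs_div, abs_neg, abs_of_pos (hm.trans_le hy1)]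
      exact div_le_div₀ (by positivity) (hK N hN y hy) hm hy1
  have hs : Tendsto (fun N : ℕ => √(N : ℝ)) atTop atTop :=
    Real.tendsto_sqrt_atTop.comp tendsto_natCast_atTop_atTop
  have t1 : Tendsto (fun N : ℕ => K / √N) atTop (𝓝 0) := tendsto_const_nhds.div_atTop hs
  have t2 : Tendsto (fun N : ℕ => Real.exp (x + 1) / N) atTop (𝓝 0) :=
    tendsto_const_nhds.div_atTop tendsto_natCast_atTop_atTop
  have t3 : Tendsto (fun N : ℕ => K / √N / min 1 x * |x - 1| +
      ((K / √N + Real.exp (x + 1) / N) + (K / √N + Real.exp (x + 1) / N))) atTop (𝓝 0) := by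
    simpa using ((t1.div_const (min 1 x)).mul_const |x - 1|).add ((t1.add t2).add (t1.add t2))
  refine squeeze_zero_norm' ?_ t3
  filter_upwards [eventually_ge_atTop 1] with N hN
  have e : (laguerreSum N).eval x + Real.log x - (laguerreSum N).eval 1 =
      (h N x - h N 1) - ((derivative (laguerre N)).eval x - (laguerre N).eval x) / N +
        ((derivative (laguerre N)).eval 1 - (laguerre N).eval 1) / N := by
    simp only [h, Real.log_one]
    ring
  rw [e, Real.norm_eq_abs]
  refine (abs_add_le _ _).trans ?_
  rw [← add_assoc]
  refine add_le_add ((abs_sub _ _).trans ?_) (hK' N hN 1 Set.left_mem_uIcc)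
  exact add_le_add (hdiff N hN) (hK' N hN x Set.right_mem_uIcc)

/-! ### Exponential integrals and the constant `-γ` -/

/-- The integral is `Γ'(1)`, obtained by differentiating the Gamma integral under the integral sign.
-/
lemma integral_log_mul_exp_neg :
    ∫ t in Set.Ioi (0 : ℝ), Real.log t * Real.exp (-t) = -Real.eulerMascheroniConstant := by
  have h1 := Complex.hasDerivAt_GammaIntegral (s := 1) (by simp)
  have h2 : HasDerivAt Complex.GammaIntegral (-(Real.eulerMascheroniConstant : ℂ)) 1 := by
    refine Complex.hasDerivAt_Gamma_one.congr_of_eventuallyEq ?_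
    have : {s : ℂ | 0 < s.re} ∈ 𝓝 (1 : ℂ) :=
      (isOpen_lt continuous_const Complex.continuous_re).mem_nhds (by simp)
    filter_upwards [this] with s hs
    exact (Complex.Gamma_eq_integral hs).symm
  have h := h1.unique h2
  simp only [sub_self, Complex.cpow_zero, one_mul] at h
  simp_rw [← Complex.ofReal_mul] at h
  rw [integral_complex_ofReal] at h
  exact_mod_cast h

/-- Apply `log s ≤ s - 1` to `s = t` and to `s = t^(-1/2)`; the exponent `-1/2` keeps the bound
integrable at `0`. -/
lemma abs_log_le_add_rpow {t : ℝ} (ht : 0 < t) : |Real.log t| ≤ t + 2 * t ^ (-(1 / 2) : ℝ) := by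
  have h1 := Real.log_le_sub_one_of_pos ht
  have h2 := Real.log_le_sub_one_of_pos (Real.rpow_pos_of_pos ht (-(1 / 2) : ℝ))
  rw [Real.log_rpow ht] at h2
  have h3 := Real.rpow_pos_of_pos ht (-(1 / 2) : ℝ)
  rw [abs_le]
  constructor <;> linarith

lemma integrableOn_abs_log_mul_exp {b : ℝ} (hb : 0 < b) :
    IntegrableOn (fun t => |Real.log t| * Real.exp (-(b * t))) (Set.Ioi 0) := by
  have h1 := integrableOn_rpow_mul_exp_neg_mul_rpow (p := 1) (s := 1) (b := b)
    (by norm_num) one_pos hb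
  have h2 := integrableOn_rpow_mul_exp_neg_mul_rpow (p := 1) (s := -(1 / 2)) (b := b)
    (by norm_num) one_pos hb
  refine Integrable.mono' (h1.add (h2.const_mul 2)) (by fun_prop) ?_
  filter_upwards [ae_restrict_mem measurableSet_Ioi] with t ht
  have := abs_log_le_add_rpow ht
  simp only [Pi.add_apply, Real.rpow_one, neg_mul, norm_mul, Real.norm_eq_abs, abs_abs,
    Real.abs_exp]
  nlinarith [Real.exp_pos (-(b * t))]

lemma integrableOn_log_mul_exp {b : ℝ} (hb : 0 < b) :
    IntegrableOn (fun t => Real.log t * Real.exp (-(b * t))) (Set.Ioi 0) := by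
  refine Integrable.mono' (integrableOn_abs_log_mul_exp hb) (by fun_prop) ?_
  filter_upwards with t
  simp

lemma integral_log_mul_exp_neg_mul {b : ℝ} (hb : 0 < b) :
    ∫ t in Set.Ioi (0 : ℝ), b * (Real.log t * Real.exp (-(b * t))) =
      -Real.eulerMascheroniConstant - Real.log b := by
  have h := integral_comp_mul_left_Ioi (fun t => Real.log t * Real.exp (-t)) 0 hb
  rw [mul_zero, integral_log_mul_exp_neg] at h
  have e : ∫ t in Set.Ioi (0 : ℝ), Real.log (b * t) * Real.exp (-(b * t)) =
      (∫ t in Set.Ioi (0 : ℝ), Real.log t * Real.exp (-(b * t))) +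
        ∫ t in Set.Ioi (0 : ℝ), Real.log b * Real.exp (-(b * t)) := by
    rw [← integral_add (integrableOn_log_mul_exp hb)]
    · refine setIntegral_congr_fun measurableSet_Ioi fun t ht => ?_
      rw [Real.log_mul hb.ne' (ne_of_gt ht)]
      ring
    · have := (exp_neg_integrableOn_Ioi 0 hb).const_mul (Real.log b)
      simpa [neg_mul] using this
  have h0 := Real.integral_rpow_mul_exp_neg_mul_Ioi (a := 1) one_pos hb
  simp only [sub_self, Real.rpow_zero, one_mul, Real.rpow_one, Real.Gamma_one, mul_one] at h0
  rw [e, integral_const_mul, h0, smul_eq_mul] at h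
  rw [integral_const_mul]
  field_simp at h
  linarith

lemma integrableOn_pow_mul_exp {b : ℝ} (hb : 0 < b) (k : ℕ) :
    IntegrableOn (fun t => t ^ k * Real.exp (-(b * t))) (Set.Ioi 0) := by
  have h := integrableOn_rpow_mul_exp_neg_mul_rpow (p := 1) (s := k) (b := b)
    (by have : (0 : ℝ) ≤ k := k.cast_nonneg
        linarith) one_pos hb
  simpa [neg_mul] using h

lemma integrableOn_eval_mul_exp {b : ℝ} (hb : 0 < b) (p : ℝ[X]) :
    IntegrableOn (fun t => p.eval t * Real.exp (-(b * t))) (Set.Ioi 0) := by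
  simp_rw [eval_eq_sum_range, Finset.sum_mul, mul_assoc]
  exact integrable_finsetSum _ fun k _ => (integrableOn_pow_mul_exp hb k).const_mul _

lemma integral_pow_mul_exp {b : ℝ} (hb : 0 < b) (k : ℕ) :
    ∫ t in Set.Ioi (0 : ℝ), t ^ k * Real.exp (-(b * t)) = k.factorial / b ^ (k + 1) := by
  have h := Real.integral_rpow_mul_exp_neg_mul_Ioi (a := (k : ℝ) + 1) (by positivity) hb
  rw [Real.Gamma_nat_eq_factorial] at h
  simp only [add_sub_cancel_right, Real.rpow_natCast] at h
  rw [h]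
  have : (1 / b) ^ ((k : ℝ) + 1) = (1 / b) ^ (k + 1) := by
    rw [← Real.rpow_natCast]; push_cast; rfl
  rw [this, one_div, inv_pow]
  field_simp

lemma integral_laguerre_mul_exp {b : ℝ} (hb : 0 < b) (N : ℕ) :
    ∫ t in Set.Ioi (0 : ℝ), b * ((laguerre N).eval t * Real.exp (-(b * t))) =
      (1 - 1 / b) ^ N := by
  simp_rw [laguerre_eval, Finset.sum_mul, mul_assoc]
  rw [integral_const_mul, integral_finsetSum]
  · rw [sub_eq_neg_add, add_pow, Finset.mul_sum]
    refine Finset.sum_congr rfl fun k _ => ?_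
    rw [integral_const_mul, integral_const_mul, integral_pow_mul_exp hb]
    have hk : (k.factorial : ℝ) ≠ 0 := by exact_mod_cast k.factorial_ne_zero
    rw [one_div, neg_pow b⁻¹, inv_pow, one_pow]
    field_simp
    ring
  · intro k _
    exact ((integrableOn_pow_mul_exp hb k).const_mul _).const_mul _

lemma integral_laguerreSum_mul_exp {b : ℝ} (hb : 0 < b) (N : ℕ) :
    ∫ t in Set.Ioi (0 : ℝ), b * ((laguerreSum N).eval t * Real.exp (-(b * t))) =
      ∑ j ∈ Finset.Icc 1 N, (1 - 1 / b) ^ j / j := by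
  simp_rw [laguerreSum, eval_finsetSum, eval_mul, eval_C, Finset.sum_mul, Finset.mul_sum]
  rw [integral_finsetSum]
  · refine Finset.sum_congr rfl fun j _ => ?_
    rw [← integral_laguerre_mul_exp hb j, ← integral_div]
    congr 1 with t
    ring
  · intro j _
    have := ((integrableOn_eval_mul_exp hb (laguerre j)).const_mul (1 / (j : ℝ))).const_mul b
    refine this.congr (ae_of_all _ fun t => ?_)
    ring

lemma tendsto_sum_pow_div {y : ℝ} (hy : |y| < 1) :
    Tendsto (fun N : ℕ => ∑ j ∈ Finset.Icc 1 N, y ^ j / j) atTop (𝓝 (-Real.log (1 - y))) := by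
  refine (Real.hasSum_pow_div_log_of_abs_lt_one hy).tendsto_sum_nat.congr fun N => ?_
  induction N with
  | zero => simp
  | succ N ih =>
    rw [Finset.sum_range_succ, ih, Finset.sum_Icc_succ_top (by omega)]
    push_cast
    rfl

/-- Integrate `S_N(t) + log t - S_N(1)`, which tends to `0`, against `3 exp (-3t)`. The first term
gives `∑ (2/3)^j / j → log 3`, the second `-γ - log 3`, the third `-S_N(1)`. -/
lemma tendsto_laguerreSum_one :
    Tendsto (fun N => (laguerreSum N).eval 1) atTop (𝓝 (-Real.eulerMascheroniConstant)) := by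
  -- The rate must exceed `1` to absorb the factor `exp (t + 1)` in the bound on the integrand; `3`
  -- leaves `exp (-2t)`.
  have hb : (0 : ℝ) < 3 := by norm_num
  let D : ℕ → ℝ → ℝ := fun N t =>
    ((laguerreSum N).eval t + Real.log t - (laguerreSum N).eval 1) * Real.exp (-(3 * t))
  have hD : Tendsto (fun N => ∫ t in Set.Ioi (0 : ℝ), D N t) atTop (𝓝 0) := by
    have := tendsto_integral_of_dominated_convergence (μ := volume.restrict (Set.Ioi (0 : ℝ)))
      (F := D) (f := fun _ => 0)
      (fun t => Real.exp 1 * (|Real.log t| * Real.exp (-(2 * t)))) (fun N => ?_)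
      ((integrableOn_abs_log_mul_exp two_pos).const_mul _) (fun N => ?_) ?_
    · simpa using this
    · have : Continuous fun t => (laguerreSum N).eval t := (laguerreSum N).continuous
      simp only [D]
      fun_prop
    · filter_upwards [ae_restrict_mem measurableSet_Ioi] with t ht
      simp only [D, norm_mul, Real.norm_eq_abs, Real.abs_exp]
      have h := abs_laguerreSum_add_log_sub_le N ht
      have e : Real.exp 1 * (|Real.log t| * Real.exp (-(2 * t))) =
          Real.exp (t + 1) * |Real.log t| * Real.exp (-(3 * t)) := by
        rw [show Real.exp (-(2 * t)) = Real.exp t * Real.exp (-(3 * t)) by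
          rw [← Real.exp_add]; ring_nf, Real.exp_add]
        ring
      rw [e]
      gcongr
    · filter_upwards [ae_restrict_mem measurableSet_Ioi] with t ht
      simpa [D] using (tendsto_laguerreSum_add_log_sub ht).mul_const (Real.exp (-(3 * t)))
  have hval : ∀ N, (laguerreSum N).eval 1 = (∑ j ∈ Finset.Icc 1 N, (1 - 1 / 3 : ℝ) ^ j / j) +
      (-Real.eulerMascheroniConstant - Real.log 3) - 3 * ∫ t in Set.Ioi (0 : ℝ), D N t := by
    intro N
    have e : ∀ t, D N t = (laguerreSum N).eval t * Real.exp (-(3 * t)) +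
        Real.log t * Real.exp (-(3 * t)) -
          (laguerreSum N).eval 1 * (t ^ 0 * Real.exp (-(3 * t))) := by
      intro t; simp only [D]; ring
    have i1 := integrableOn_eval_mul_exp hb (laguerreSum N)
    have i2 := integrableOn_log_mul_exp hb
    have i3 := (integrableOn_pow_mul_exp hb 0).const_mul ((laguerreSum N).eval 1)
    rw [← integral_laguerreSum_mul_exp hb, ← integral_log_mul_exp_neg_mul hb,
      integral_const_mul, integral_const_mul]
    have hDi : ∫ t in Set.Ioi (0 : ℝ), D N t =
        (∫ t in Set.Ioi (0 : ℝ), (laguerreSum N).eval t * Real.exp (-(3 * t))) +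
        (∫ t in Set.Ioi (0 : ℝ), Real.log t * Real.exp (-(3 * t))) -
          ∫ t in Set.Ioi (0 : ℝ), (laguerreSum N).eval 1 * (t ^ 0 * Real.exp (-(3 * t))) := by
      rw [← integral_add i1 i2]
      refine Eq.trans ?_ (integral_sub (i1.add i2) i3)
      exact integral_congr_ae (ae_of_all _ e)
    rw [hDi, integral_const_mul, integral_pow_mul_exp hb]
    norm_num
    ring
  have hs := tendsto_sum_pow_div (y := 1 - 1 / 3) (by rw [abs_lt]; norm_num)
  have := (hs.add_const (-Real.eulerMascheroniConstant - Real.log 3)).sub (hD.const_mul 3)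
  refine (this.congr fun N => (hval N).symm).trans_eq ?_
  congr 1
  rw [sub_sub_cancel, one_div, Real.log_inv]
  ring

lemma tendsto_laguerreSum {x : ℝ} (hx : 0 < x) :
    Tendsto (fun N => (laguerreSum N).eval x) atTop
      (𝓝 (-Real.log x - Real.eulerMascheroniConstant)) := by
  have := ((tendsto_laguerreSum_add_log_sub hx).add tendsto_laguerreSum_one).sub_const (Real.log x)
  refine (this.congr fun N => ?_).trans_eq ?_
  · ring
  · congr 1; ring

lemma exists_abs_laguerreSum_le :
    ∃ K, 0 ≤ K ∧ ∀ N x, 0 < x → |(laguerreSum N).eval x| ≤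
      K + (Real.exp (x + 1) + 1) * |Real.log x| := by
  obtain ⟨K, hK⟩ := (tendsto_laguerreSum_one.abs).bddAbove_range
  have hK' : ∀ N, |(laguerreSum N).eval 1| ≤ K := fun N => hK ⟨N, rfl⟩
  refine ⟨K, (abs_nonneg _).trans (hK' 0), fun N x hx => ?_⟩
  have h := abs_laguerreSum_add_log_sub_le N hx
  calc |(laguerreSum N).eval x|
      = |(laguerreSum N).eval 1 + ((laguerreSum N).eval x + Real.log x - (laguerreSum N).eval 1)
          + -Real.log x| := by congr 1; ring
    _ ≤ |(laguerreSum N).eval 1| +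
        |(laguerreSum N).eval x + Real.log x - (laguerreSum N).eval 1| + |-Real.log x| :=
      abs_add_three _ _ _
    _ ≤ K + Real.exp (x + 1) * |Real.log x| + |Real.log x| := by
      rw [abs_neg]
      gcongr
      exact hK' N
    _ = _ := by ring

/-! ### Passage from pointwise limits to moments -/

/-- The terms are nonnegative, so the partial sums increase to `-log y`. -/
lemma abs_sum_one_sub_pow_div_le {y : ℝ} (h0 : 0 < y) (h1 : y ≤ 1) (N : ℕ) :
    |∑ j ∈ Finset.Icc 1 N, (1 - y) ^ j / j| ≤ |Real.log y| := by
  have hm : Monotone fun N : ℕ => ∑ j ∈ Finset.Icc 1 N, (1 - y) ^ j / (j : ℝ) := by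
    refine monotone_nat_of_le_succ fun N => ?_
    rw [Finset.sum_Icc_succ_top (by omega)]
    have : 0 ≤ (1 - y) ^ (N + 1) := pow_nonneg (by linarith) _
    have : 0 ≤ (1 - y) ^ (N + 1) / ((N + 1 : ℕ) : ℝ) := by positivity
    linarith
  have ht := tendsto_sum_pow_div (y := 1 - y) (by rw [abs_lt]; constructor <;> linarith)
  rw [sub_sub_cancel] at ht
  rw [abs_of_nonneg, abs_of_nonpos (Real.log_nonpos h0.le h1)]
  · exact hm.ge_of_tendsto ht N
  · exact Finset.sum_nonneg fun j _ => div_nonneg (pow_nonneg (by linarith) _) j.cast_nonneg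

/-- The limit formula for the moments of a positive bounded random variable with integrable
logarithm. -/
theorem tendsto_sum_moments {Ω : Type*} [MeasurableSpace Ω] {μ : Measure Ω}
    [IsProbabilityMeasure μ] {X : Ω → ℝ} (hX : Measurable X) {c : ℝ} (hc : 1 ≤ c)
    (hpos : ∀ᵐ ω ∂μ, 0 < X ω) (hle : ∀ᵐ ω ∂μ, X ω ≤ c)
    (hlog : Integrable (fun ω => Real.log (X ω)) μ) :
    Tendsto (fun N : ℕ => ∑ j ∈ Finset.Icc 1 N, (1 / (j : ℝ)) *
        ∑ k ∈ Finset.range (j + 1), (j.choose k : ℝ) * ((-1) ^ k * ∫ ω, X ω ^ k ∂μ) *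
          (1 / c ^ k - 1 / (k.factorial : ℝ))) atTop
      (𝓝 (Real.log c + Real.eulerMascheroniConstant)) := by
  have hc0 : 0 < c := by linarith
  -- Expanding by the binomial theorem, `1 / c^k` comes from `(1 - X/c)^j` and `1 / k!` from `L_j`.
  let f : ℕ → Ω → ℝ := fun N ω =>
    ∑ j ∈ Finset.Icc 1 N, (1 - X ω / c) ^ j / j - (laguerreSum N).eval (X ω)
  have hint : ∀ k, Integrable (fun ω => X ω ^ k) μ := by
    intro k
    refine Integrable.of_bound (by fun_prop) (c ^ k) ?_
    filter_upwards [hpos, hle] with ω h1 h2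
    rw [norm_pow, Real.norm_eq_abs, abs_of_pos h1]
    gcongr
  have hf : ∀ N, ∫ ω, f N ω ∂μ = ∑ j ∈ Finset.Icc 1 N, (1 / (j : ℝ)) *
        ∑ k ∈ Finset.range (j + 1), (j.choose k : ℝ) * ((-1) ^ k * ∫ ω, X ω ^ k ∂μ) *
          (1 / c ^ k - 1 / (k.factorial : ℝ)) := by
    intro N
    have e : ∀ ω, f N ω = ∑ j ∈ Finset.Icc 1 N, (1 / (j : ℝ)) *
        ∑ k ∈ Finset.range (j + 1), (j.choose k : ℝ) * ((-1) ^ k * X ω ^ k) *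
          (1 / c ^ k - 1 / (k.factorial : ℝ)) := by
      intro ω
      simp only [f, laguerreSum, eval_finsetSum, eval_mul, eval_C]
      rw [← Finset.sum_sub_distrib]
      refine Finset.sum_congr rfl fun j _ => ?_
      rw [laguerre_eval, sub_eq_neg_add 1, add_pow, div_eq_mul_one_div, mul_comm, ← mul_sub,
        ← Finset.sum_sub_distrib]
      congr 1
      refine Finset.sum_congr rfl fun k _ => ?_
      rw [neg_pow, div_pow, one_pow]
      ring
    simp_rw [e]
    rw [integral_finsetSum]
    · refine Finset.sum_congr rfl fun j _ => ?_
      rw [integral_const_mul, integral_finsetSum]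
      · congr 1
        refine Finset.sum_congr rfl fun k _ => ?_
        rw [integral_mul_const, integral_const_mul, integral_const_mul]
      · exact fun k _ => (((hint k).const_mul _).const_mul _).mul_const _
    · exact fun j _ => (integrable_finsetSum _
        fun k _ => (((hint k).const_mul _).const_mul _).mul_const _).const_mul _
  obtain ⟨K, hK0, hK⟩ := exists_abs_laguerreSum_le
  have key := tendsto_integral_of_dominated_convergence (μ := μ)
    (F := f) (f := fun _ => Real.log c + Real.eulerMascheroniConstant)
    (fun ω => (|Real.log (X ω)| + |Real.log c|) +
      (K + (Real.exp (c + 1) + 1) * |Real.log (X ω)|)) (fun N => ?_) ?_ (fun N => ?_) ?_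
  · simp_rw [hf] at key
    simpa using key
  · have : Continuous fun t => (laguerreSum N).eval t := (laguerreSum N).continuous
    simp only [f]
    fun_prop
  · exact (hlog.abs.add (integrable_const _)).add ((integrable_const _).add (hlog.abs.const_mul _))
  · filter_upwards [hpos, hle] with ω h1 h2
    rw [Real.norm_eq_abs]
    refine (abs_sub _ _).trans (add_le_add ?_ ?_)
    · refine (abs_sum_one_sub_pow_div_le (div_pos h1 hc0) ((div_le_one hc0).2 h2) N).trans ?_
      rw [Real.log_div h1.ne' hc0.ne']
      exact abs_sub _ _
    · refine (hK N _ h1).trans ?_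
      gcongr
  · filter_upwards [hpos, hle] with ω h1 h2
    have hy : 0 < X ω / c := div_pos h1 hc0
    have hy' : X ω / c ≤ 1 := (div_le_one hc0).2 h2
    have t1 := tendsto_sum_pow_div (y := 1 - X ω / c)
      (by rw [abs_lt]; constructor <;> linarith)
    refine (t1.sub (tendsto_laguerreSum h1)).trans_eq ?_
    congr 1
    rw [sub_sub_cancel, Real.log_div h1.ne' hc0.ne']
    ring

/-! ### The logarithm of an affine function on the circle -/

open AddCircle in
lemma integrable_haarAddCircle_of_circleIntegrable {g : ℂ → ℝ} (hg : Measurable g)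
    (h : CircleIntegrable g 0 1) :
    Integrable (fun θ : AddCircle (2 * Real.pi) => g (toCircle θ)) haarAddCircle := by
  have hm : Measurable fun θ : AddCircle (2 * Real.pi) => g (toCircle θ) :=
    hg.comp ((continuous_subtype_val.comp continuous_toCircle).measurable)
  have hv : Integrable (fun θ : AddCircle (2 * Real.pi) => g (toCircle θ)) volume := by
    rw [← (AddCircle.measurePreserving_mk (2 * Real.pi) 0).integrable_comp
      hm.aestronglyMeasurable]
    have := h.1
    rw [zero_add]
    refine this.congr (ae_of_all _ fun θ => ?_)
    simp [circleMap, toCircle_apply_mk, Circle.coe_exp]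
  rw [volume_eq_smul_haarAddCircle] at hv
  exact (integrable_smul_measure (by simp [Real.pi_pos]) ENNReal.ofReal_ne_top).1 hv

open AddCircle in
lemma integral_haarAddCircle_eq_circleAverage (g : ℂ → ℝ) :
    ∫ θ : AddCircle (2 * Real.pi), g (toCircle θ) ∂haarAddCircle = Real.circleAverage g 0 1 := by
  rw [integral_haarAddCircle, ← AddCircle.intervalIntegral_preimage (2 * Real.pi) 0, zero_add,
    Real.circleAverage_def]
  congr 1
  refine intervalIntegral.integral_congr fun θ _ => ?_
  simp [circleMap, toCircle_apply_mk, Circle.coe_exp]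

/-- Multiplying by the unimodular `‖w‖ / w` turns `a + w z` into a point of the circle of radius
`‖w‖` minus a constant. Jensen's formula then gives `log ‖w‖` plus a nonnegative `log⁺`. -/
lemma log_norm_le_circleAverage_log_norm_add_mul (a : ℂ) {w : ℂ} (hw : w ≠ 0) :
    Real.log ‖w‖ ≤ Real.circleAverage (fun z => Real.log ‖a + w * z‖) 0 1 := by
  have hw' : ‖w‖ ≠ 0 := norm_ne_zero_iff.2 hw
  have e : (fun z => Real.log ‖a + w * z‖) =
      fun z => Real.log ‖((‖w‖ : ℝ) * z + 0 : ℂ) - (-(a * ‖w‖ / w))‖ := by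
    ext z
    have : ((‖w‖ : ℝ) * z + 0 : ℂ) - (-(a * ‖w‖ / w)) = ‖w‖ / w * (a + w * z) := by
      field_simp
      ring
    rw [this, norm_mul, norm_div, Complex.norm_real, norm_norm, div_self hw', one_mul]
  have h := Real.circleAverage_eq_circleAverage_zero_one (c := 0) (R := ‖w‖)
    (f := fun z => Real.log ‖z - (-(a * ‖w‖ / w))‖)
  rw [e, ← h, circleAverage_log_norm_sub_const_eq_log_radius_add_posLog hw']
  have := Real.posLog_nonneg (x := ‖w‖⁻¹ * ‖0 - (-(a * ‖w‖ / w))‖)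
  linarith

open AddCircle in
-- Where `log ≤ log⁺ M`, one has `|log| ≤ 2 log⁺ M - log`, so the lower bound on the mean of `log`
-- suffices. The result depends on `a` only through `M`.
lemma lintegral_abs_log_norm_add_mul_le (a : ℂ) {w : ℂ} (hw : w ≠ 0) {M : ℝ}
    (hM : ‖a‖ + ‖w‖ ≤ M) :
    ∫⁻ θ : AddCircle (2 * Real.pi), ‖Real.log ‖a + w * toCircle θ‖‖ₑ ∂haarAddCircle ≤
      ENNReal.ofReal (2 * Real.posLog M - Real.log ‖w‖) := by
  have hi : Integrable (fun θ : AddCircle (2 * Real.pi) => Real.log ‖a + w * toCircle θ‖)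
      haarAddCircle := by
    refine integrable_haarAddCircle_of_circleIntegrable (g := fun z => Real.log ‖a + w * z‖)
      (by fun_prop) ?_
    exact MeromorphicOn.circleIntegrable_log_norm (f := fun z => a + w * z)
      (fun _ _ => by fun_prop)
  rw [← ofReal_integral_norm_eq_lintegral_enorm hi]
  refine ENNReal.ofReal_le_ofReal ?_
  have h1 : ∫ θ : AddCircle (2 * Real.pi), ‖Real.log ‖a + w * toCircle θ‖‖ ∂haarAddCircle ≤
      ∫ θ : AddCircle (2 * Real.pi), (2 * Real.posLog M - Real.log ‖a + w * toCircle θ‖)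
        ∂haarAddCircle := by
    refine integral_mono hi.norm ((integrable_const _).sub hi) fun θ => ?_
    have hle : ‖a + w * toCircle θ‖ ≤ M := by
      refine (norm_add_le _ _).trans ?_
      rwa [norm_mul, Circle.norm_coe, mul_one]
    have h2 := Real.posLog_le_posLog (norm_nonneg _) hle
    have h3 : Real.log ‖a + w * toCircle θ‖ ≤ Real.posLog ‖a + w * toCircle θ‖ :=
      le_max_right _ _
    have h4 := Real.posLog_nonneg (x := M)
    simp only [Real.norm_eq_abs]
    rw [abs_le]
    constructor <;> linarith
  refine h1.trans ?_
  rw [integral_sub (integrable_const _) hi,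
    integral_haarAddCircle_eq_circleAverage (fun z => Real.log ‖a + w * z‖)]
  have := log_norm_le_circleAverage_log_norm_add_mul a hw
  simp only [integral_const, probReal_univ, one_smul]
  linarith

open AddCircle in
lemma ae_add_mul_toCircle_ne_zero (a : ℂ) {w : ℂ} (hw : w ≠ 0) :
    ∀ᵐ θ : AddCircle (2 * Real.pi) ∂haarAddCircle, a + w * toCircle θ ≠ 0 := by
  have hs : {θ : AddCircle (2 * Real.pi) | a + w * toCircle θ = 0}.Subsingleton := by
    intro θ hθ φ hφ
    refine injective_toCircle Real.two_pi_pos.ne' (Circle.ext ?_)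
    have : w * toCircle θ = w * toCircle φ := by
      have h1 : a + w * toCircle θ = 0 := hθ
      have h2 : a + w * toCircle φ = 0 := hφ
      linear_combination h1 - h2
    exact mul_left_cancel₀ hw this
  have h0 : ∀ θ : AddCircle (2 * Real.pi), haarAddCircle {θ} = 0 := by
    intro θ
    have hv : (volume : Measure (AddCircle (2 * Real.pi))) {θ} = 0 := by
      have h := AddCircle.volume_closedBall (2 * Real.pi) (x := θ) 0
      rw [Metric.closedBall_zero] at h
      simpa [Real.pi_pos.le] using h
    rw [volume_eq_smul_haarAddCircle, Measure.smul_apply, smul_eq_mul, mul_eq_zero] at hv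
    exact hv.resolve_left (by simp [Real.pi_pos])
  have := hs.eq_empty_or_singleton
  rw [ae_iff]
  simp only [ne_eq, not_not]
  rcases this with h | ⟨θ, h⟩
  · rw [h, measure_empty]
  · rw [h, h0]

open AddCircle in
lemma integral_fourier_haarAddCircle (m : ℤ) :
    ∫ θ : AddCircle (2 * Real.pi), fourier m θ ∂haarAddCircle = if m = 0 then 1 else 0 := by
  have h := congrFun (fourierCoeff_fourier (T := 2 * Real.pi) m) 0
  simp only [fourierCoeff, neg_zero, fourier_zero, one_smul] at h
  rw [h, Pi.single_apply]
  simp [eq_comm]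

/-! ### Linear forms on the torus -/

/-- The linear form with coefficients `W` on the torus. -/
noncomputable def torusForm {n : ℕ} (W : Fin (n + 1) → ℂ)
    (x : Fin (n + 1) → AddCircle (2 * Real.pi)) : ℂ :=
  ∑ i, W i * (AddCircle.toCircle (x i) : ℂ)

/-- The normalised Haar measure on the torus. -/
noncomputable abbrev torusMeasure (n : ℕ) : Measure (Fin (n + 1) → AddCircle (2 * Real.pi)) :=
  Measure.pi fun _ => AddCircle.haarAddCircle

lemma continuous_torusForm {n : ℕ} (W : Fin (n + 1) → ℂ) : Continuous (torusForm W) := by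
  refine continuous_finsetSum _ fun i _ => continuous_const.mul ?_
  exact continuous_subtype_val.comp (AddCircle.continuous_toCircle.comp (continuous_apply i))

lemma torusForm_add_single {n : ℕ} (W : Fin (n + 1) → ℂ)
    (x : Fin (n + 1) → AddCircle (2 * Real.pi)) (i : Fin (n + 1)) (θ : AddCircle (2 * Real.pi)) :
    torusForm W (x + Pi.single i θ) =
      (∑ j ∈ Finset.univ.erase i, W j * (AddCircle.toCircle (x j) : ℂ)) +
        W i * AddCircle.toCircle (x i) * AddCircle.toCircle θ := by
  rw [torusForm, ← Finset.sum_erase_add _ _ (Finset.mem_univ i)]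
  congr 1
  · refine Finset.sum_congr rfl fun j hj => ?_
    rw [Pi.add_apply, Pi.single_eq_of_ne (Finset.ne_of_mem_erase hj), add_zero]
  · simp [AddCircle.toCircle_add, mul_assoc]

/-- Translation invariance of Haar measure: averaging over rotations of one coordinate reduces torus
estimates to the circle, without splitting the product. -/
lemma lintegral_torus_eq_add_single {n : ℕ} (i : Fin (n + 1))
    {G : (Fin (n + 1) → AddCircle (2 * Real.pi)) → ENNReal} (hG : Measurable G) :
    ∫⁻ x, G x ∂torusMeasure n =
      ∫⁻ x, ∫⁻ θ, G (x + Pi.single i θ) ∂AddCircle.haarAddCircle ∂torusMeasure n := by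
  rw [lintegral_lintegral_swap]
  · simp_rw [lintegral_add_right_eq_self G]
    simp
  · have : Measurable fun p : (Fin (n + 1) → AddCircle (2 * Real.pi)) × AddCircle (2 * Real.pi) =>
        p.1 + Pi.single i p.2 := by
      refine Continuous.measurable ?_
      exact continuous_fst.add ((continuous_single i).comp continuous_snd)
    exact (hG.comp this).aemeasurable

lemma integrable_log_norm_torusForm {n : ℕ} {W : Fin (n + 1) → ℂ} (hW : W ≠ 0) :
    Integrable (fun x => Real.log ‖torusForm W x‖) (torusMeasure n) := by
  obtain ⟨i, hi⟩ := Function.ne_iff.1 hW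
  have hm : Measurable fun x => Real.log ‖torusForm W x‖ :=
    Real.measurable_log.comp (continuous_torusForm W).measurable.norm
  refine ⟨hm.aestronglyMeasurable, ?_⟩
  rw [hasFiniteIntegral_iff_enorm, lintegral_torus_eq_add_single i hm.enorm]
  refine (lintegral_mono (g := fun _ =>
    ENNReal.ofReal (2 * Real.posLog (∑ j, ‖W j‖) - Real.log ‖W i‖)) fun x => ?_).trans_lt ?_
  · simp_rw [torusForm_add_single]
    have hne : W i * (AddCircle.toCircle (x i) : ℂ) ≠ 0 := mul_ne_zero hi (by simp)
    refine (lintegral_abs_log_norm_add_mul_le _ hne (M := ∑ j, ‖W j‖) ?_).trans_eq ?_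
    · rw [← Finset.sum_erase_add _ _ (Finset.mem_univ i)]
      refine add_le_add ((norm_sum_le _ _).trans_eq ?_) ?_
      · simp_rw [norm_mul, Circle.norm_coe, mul_one]
      · rw [norm_mul, Circle.norm_coe, mul_one]
    · rw [norm_mul, Circle.norm_coe, mul_one]
  · simp

/-- Needed apart from integrability of the logarithm, because `Real.log 0 = 0`. On each circle in
direction `i` the form vanishes at most once. -/
lemma ae_torusForm_ne_zero {n : ℕ} {W : Fin (n + 1) → ℂ} (hW : W ≠ 0) :
    ∀ᵐ x ∂torusMeasure n, torusForm W x ≠ 0 := by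
  obtain ⟨i, hi⟩ := Function.ne_iff.1 hW
  have hs : MeasurableSet {x | torusForm W x = 0} :=
    (isClosed_eq (continuous_torusForm W) continuous_const).measurableSet
  rw [ae_iff]
  simp only [ne_eq, not_not]
  rw [← lintegral_indicator_one hs,
    lintegral_torus_eq_add_single i (measurable_one.indicator hs)]
  refine (lintegral_congr fun x => ?_).trans lintegral_zero
  have hne : W i * (AddCircle.toCircle (x i) : ℂ) ≠ 0 := mul_ne_zero hi (by simp)
  refine (lintegral_congr_ae ?_).trans lintegral_zero
  filter_upwards [ae_add_mul_toCircle_ne_zero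
    (∑ j ∈ Finset.univ.erase i, W j * (AddCircle.toCircle (x j) : ℂ)) hne] with θ hθ
  rw [← torusForm_add_single] at hθ
  simp [hθ]

lemma integral_torus_monomial {n : ℕ} (l m : Fin (n + 1) → ℕ) :
    ∫ x, ∏ i, ((AddCircle.toCircle (x i) : ℂ) ^ l i *
        starRingEnd ℂ ((AddCircle.toCircle (x i) : ℂ) ^ m i)) ∂torusMeasure n =
      if l = m then 1 else 0 := by
  rw [integral_fintype_prod_eq_prod (μ := fun _ => AddCircle.haarAddCircle)
    (fun i (θ : AddCircle (2 * Real.pi)) => (AddCircle.toCircle θ : ℂ) ^ l i *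
        starRingEnd ℂ ((AddCircle.toCircle θ : ℂ) ^ m i))]
  have h : ∀ i, ∫ θ : AddCircle (2 * Real.pi), (AddCircle.toCircle θ : ℂ) ^ l i *
        starRingEnd ℂ ((AddCircle.toCircle θ : ℂ) ^ m i) ∂AddCircle.haarAddCircle =
      if l i = m i then 1 else 0 := by
    intro i
    have e : ∀ θ : AddCircle (2 * Real.pi), (AddCircle.toCircle θ : ℂ) ^ l i *
        starRingEnd ℂ ((AddCircle.toCircle θ : ℂ) ^ m i) = fourier ((l i : ℤ) + -(m i : ℤ)) θ := by
      intro θ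
      rw [fourier_add, fourier_neg, fourier_apply, fourier_apply]
      simp [AddCircle.toCircle_nsmul]
    simp_rw [e, integral_fourier_haarAddCircle]
    congr 1
    simp only [eq_iff_iff]
    omega
  simp_rw [h]
  split_ifs with hlm
  · simp [hlm]
  · obtain ⟨i, hi⟩ := Function.ne_iff.1 hlm
    exact Finset.prod_eq_zero (Finset.mem_univ i) (if_neg hi)

/-- The even moments of a linear form on the torus. -/
lemma integral_norm_torusForm_pow {n : ℕ} (D : EuclideanSpace ℂ (Fin (n + 1))) (k : ℕ) :
    ∫ x, ‖torusForm D x‖ ^ (2 * k) ∂torusMeasure n = mahlerCoeff n k D := by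
  have hpow : ∀ x, torusForm D x ^ k =
      ∑ l ∈ Finset.piAntidiag (Finset.univ : Finset (Fin (n + 1))) k,
        ((Nat.multinomial Finset.univ l : ℂ) * ∏ i, D i ^ l i) *
          ∏ i, (AddCircle.toCircle (x i) : ℂ) ^ l i := by
    intro x
    rw [torusForm, Finset.sum_pow_eq_sum_piAntidiag]
    simp_rw [mul_pow, Finset.prod_mul_distrib, mul_assoc]
  have e : ∀ x, ((‖torusForm D x‖ ^ (2 * k) : ℝ) : ℂ) =
      ∑ l ∈ Finset.piAntidiag (Finset.univ : Finset (Fin (n + 1))) k,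
      ∑ m ∈ Finset.piAntidiag (Finset.univ : Finset (Fin (n + 1))) k,
        (((Nat.multinomial Finset.univ l : ℂ) * ∏ i, D i ^ l i) *
          starRingEnd ℂ ((Nat.multinomial Finset.univ m : ℂ) * ∏ i, D i ^ m i)) *
        ∏ i, ((AddCircle.toCircle (x i) : ℂ) ^ l i *
          starRingEnd ℂ ((AddCircle.toCircle (x i) : ℂ) ^ m i)) := by
    intro x
    rw [mul_comm, pow_mul, ← norm_pow, Complex.ofReal_pow, ← Complex.mul_conj', hpow, map_sum,
      Finset.sum_mul_sum]
    refine Finset.sum_congr rfl fun l _ => Finset.sum_congr rfl fun m _ => ?_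
    rw [Finset.prod_mul_distrib, ← map_prod, map_mul _ (_ * _) (∏ i, _)]
    ring
  have hint : ∀ l m : Fin (n + 1) → ℕ,
      Integrable (fun x : Fin (n + 1) → AddCircle (2 * Real.pi) =>
        ∏ i, ((AddCircle.toCircle (x i) : ℂ) ^ l i *
          starRingEnd ℂ ((AddCircle.toCircle (x i) : ℂ) ^ m i))) (torusMeasure n) := by
    intro l m
    refine Integrable.of_bound (C := 1) ?_ (ae_of_all _ fun x => ?_)
    · refine Continuous.aestronglyMeasurable (continuous_finsetProd _ fun i _ => ?_)
      have : Continuous fun x : Fin (n + 1) → AddCircle (2 * Real.pi) =>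
          (AddCircle.toCircle (x i) : ℂ) :=
        continuous_subtype_val.comp (AddCircle.continuous_toCircle.comp (continuous_apply i))
      exact (this.pow _).mul (Complex.continuous_conj.comp (this.pow _))
    · simp_rw [norm_prod, norm_mul, RCLike.norm_conj, norm_pow, Circle.norm_coe, one_pow, mul_one]
      simp
  have hC : ((∫ x, ‖torusForm D x‖ ^ (2 * k) ∂torusMeasure n : ℝ) : ℂ) = mahlerCoeff n k D := by
    rw [← integral_complex_ofReal]
    simp_rw [e]
    rw [integral_finsetSum _ fun l _ => integrable_finsetSum _ fun m _ => (hint l m).const_mul _,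
      mahlerCoeff, Complex.ofReal_sum]
    refine Finset.sum_congr rfl fun l hl => ?_
    rw [integral_finsetSum _ fun m _ => (hint l m).const_mul _]
    simp_rw [integral_const_mul, integral_torus_monomial]
    -- Orthogonality leaves only the diagonal `l = m`, hence the squared multinomials.
    rw [Finset.sum_eq_single_of_mem l hl fun m _ hm => by rw [if_neg hm.symm, mul_zero],
      if_pos rfl, mul_one, Complex.mul_conj']
    rw [← Complex.ofReal_pow, norm_mul, norm_prod, mul_pow, ← Finset.prod_pow]
    congr 1
    simp [pow_mul, pow_right_comm]
  exact_mod_cast hC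

/-! ### The limit formula for the coefficients -/

theorem corollary1p3 (n : ℕ) (D : EuclideanSpace ℂ (Fin (n + 1))) (hD : D ≠ 0) :
    Filter.Tendsto
      (fun N : ℕ => ∑ j ∈ Finset.Icc 1 N, (1 / (j : ℝ)) *
        ∑ k ∈ Finset.range (j + 1),
          (Nat.choose j k : ℝ) * ((-1 : ℝ) ^ k * mahlerCoeff n k D / ‖D‖ ^ (2 * k)) *
            (1 / ((n : ℝ) + 1) ^ k - 1 / (Nat.factorial k : ℝ)))
      Filter.atTop
      (nhds (Real.log ((n : ℝ) + 1) + Real.eulerMascheroniConstant)) := by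
  have hD0 : 0 < ‖D‖ := norm_pos_iff.2 hD
  have hW : (D : Fin (n + 1) → ℂ) ≠ 0 := by
    intro h
    exact hD (by ext i; exact congrFun h i)
  have hae := ae_torusForm_ne_zero hW
  have hX : Measurable fun x => ‖torusForm D x‖ ^ 2 / ‖D‖ ^ 2 :=
    ((continuous_torusForm D).measurable.norm.pow_const 2).div_const _
  have key := tendsto_sum_moments (μ := torusMeasure n) hX (c := (n : ℝ) + 1)
    (by have : (0 : ℝ) ≤ n := n.cast_nonneg
        linarith) ?_ ?_ ?_
  · refine key.congr fun N => ?_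
    refine Finset.sum_congr rfl fun j _ => ?_
    congr 1
    refine Finset.sum_congr rfl fun k _ => ?_
    rw [← integral_norm_torusForm_pow, mul_div_assoc, ← integral_div]
    simp_rw [div_pow, ← pow_mul]
  · filter_upwards [hae] with x hx
    have := norm_pos_iff.2 hx
    positivity
  · refine ae_of_all _ fun x => ?_
    rw [div_le_iff₀ (by positivity), EuclideanSpace.norm_sq_eq]
    have h1 : ‖torusForm D x‖ ≤ ∑ i, ‖D i‖ := by
      refine (norm_sum_le _ _).trans_eq ?_
      simp_rw [norm_mul, Circle.norm_coe, mul_one]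
    refine (pow_le_pow_left₀ (norm_nonneg _) h1 2).trans ?_
    -- Cauchy–Schwarz over the `n + 1` coordinates, the origin of the constant `n + 1`.
    have := sq_sum_le_card_mul_sum_sq (s := Finset.univ) (f := fun i => ‖D i‖)
    simpa using this
  · refine (((integrable_log_norm_torusForm hW).const_mul 2).sub
      (integrable_const (2 * Real.log ‖D‖))).congr ?_
    filter_upwards [hae] with x hx
    rw [Real.log_div (by simpa using hx) (by positivity), Real.log_pow, Real.log_pow]
    simp
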